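/- Let $k\ge 1$ and let $1\le s_1<s_2<\dots<s_k$ be integers. For $n\ge 1$ let $C_{2n}(s_1,\dots,s_k,n)$ be the circulant graph of odd valency $2k+1$ with vertex set $\mathbb Z/2n\mathbb Z$, in which every vertex $i$ is joined to $i+s_j$ and $i-s_j$ for $j=1,\dots,k$, and once to $i+n$. More precisely, its edges are: for each vertex $i$ and each $j$, one edge between $i$ and $i+s_j$; and for each $i=0,\dots,n-1$, one edge between $i$ and $i+n$. For $n>s_k$ this is a simple graph; for $n\le s_k$ it is understood as a multigraph, that is, loops and parallel edges are kept. Let $\tau(n)$ be the number of spanning trees of $C_{2n}(s_1,\dots,s_k,n)$, parallel edges being distinguished (so $\tau(n)=0$ if the graph is disconnected). Then the generating function $$F(x)=\sum_{n=1}^{\infty}\tau(n)\,x^n$$ is a rational function with integer coefficients, i.e. it is the expansion at $x=0$ of a quotient of two polynomials in $\mathbb Z[x]$. Moreover, as an identity of rational functions, $F(x)=F(1/x)$. -/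

import Mathlib

open scoped Polynomial PowerSeries LaurentSeries

/-- A multigraph is a tree if it has no loops and no parallel edges (no cycles of length one or two)
and the simple graph it then is, is a tree (nonempty, connected, without cycles). -/
def Graph.IsTree {α β : Type*} (G : Graph α β) : Prop :=
  G.Simple ∧ G.toSimpleGraph.IsTree

/-- The number of spanning trees of a multigraph: the number of its spanning subgraphs
(same vertex set, some of the edges) that are trees. -/
noncomputable def Graph.numSpanningTrees {α β : Type*} (G : Graph α β) : ℕ :=
  {T : Graph α β | T.IsSpanningSubgraph G ∧ T.IsTree}.ncard

/-- The odd-valency circulant graph `C_{2n}(s_1, …, s_k, n)`, on the vertices `ℤ/2n`.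
For each vertex `i` and each `j` there is one edge joining `i` to `i + s_j`
(so every vertex `i` is joined to `i + s_j` and to `i - s_j`);
for each `i = 0, …, n - 1` there is one edge joining `i` to `i + n`
(so every vertex `i` is joined once to `i + n = i - n`).
Each vertex has valency `2 k + 1`, loops being counted twice.
If all `s_j` are positive, distinct and less than `n`, there are no loops or parallel edges and this
is the usual simple circulant graph; otherwise loops and parallel edges are kept. -/
def oddCirculant (n : ℕ) {k : ℕ} (s : Fin k → ℕ) :
    Graph (ZMod (2 * n)) ((ZMod (2 * n) × Fin k) ⊕ Fin n) where
  vertexSet := Set.univ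
  IsLink e x y :=
    match e with
    | .inl (i, j) => s(x, y) = s(i, i + (s j : ZMod (2 * n)))
    | .inr i => s(x, y) = s(((i : ℕ) : ZMod (2 * n)), ((i : ℕ) : ZMod (2 * n)) + (n : ZMod (2 * n)))
  edgeSet := Set.univ
  isLink_symm e _ := ⟨fun x y h => by
    rcases e with ⟨i, j⟩ | i <;> simpa only [Sym2.eq_swap (a := y) (b := x)] using h⟩
  eq_or_eq_of_isLink_of_isLink e x y v w h h' := by
    rcases e with ⟨i, j⟩ | i <;>
    · have := h.trans h'.symm
      rw [Sym2.eq_iff] at this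
      tauto
  edge_mem_iff_exists_isLink e := by
    rcases e with ⟨i, j⟩ | i
    · exact ⟨fun _ => ⟨_, _, rfl⟩, fun _ => Set.mem_univ _⟩
    · exact ⟨fun _ => ⟨_, _, rfl⟩, fun _ => Set.mem_univ _⟩
  left_mem_of_isLink _ _ _ _ := Set.mem_univ _

/-- The formal power series `∑_{n ≥ 1} τ(n) x ^ n`, where `τ(n)` is the number of spanning trees of
`C_{2n}(s_1, …, s_k, n)`. -/
noncomputable def spanningTreeSeries {k : ℕ} (s : Fin k → ℕ) : ℚ⟦X⟧ :=
  PowerSeries.mk fun n => if n = 0 then 0 else ((oddCirculant n s).numSpanningTrees : ℚ)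

/-! By the matrix-tree theorem τ(n) is a principal cofactor of the Laplacian
(`adjugate_laplacian_eq_numSpanningTrees`). The Fourier transform on ℤ/2n makes 2n·τ(n) the product
of P(w + w⁻¹) + 1 - wⁿ over the 2n-th roots of unity w ≠ 1, with P = `stepPolynomial s`. Here 1 - wⁿ
is 0 or 2 according as wⁿ = 1 or wⁿ = -1, so only values of P and P + 2 occur. Split these into
linear factors w + w⁻¹ - t and write t = z + z⁻¹: the product of such a factor over all w with wⁿ =
a = ±1 is (-1)ⁿ(zⁿ + z⁻ⁿ - 2a). The root t = 2 of P is simple and yields n² up to sign. Sequences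
spanned by uⁿ + u⁻ⁿ are closed under products, so τ(n) = n·a(n) with a in that span
(`exists_numSpanningTrees_eq_mul`). Small n need no separate treatment: a loop is a zero column of
the incidence matrix.

The series ∑ n(uⁿ + u⁻ⁿ)xⁿ is ux/(1 - ux)² + u⁻¹x/(1 - u⁻¹x)², and x ↦ 1/x swaps the two summands.
The symmetry is recorded as numerator and denominator being palindromic for one common degree, a
condition on coefficients that survives linear combinations and descends from ℂ to ℚ
(`PowerSeries.IsPalindromicRational.of_map`). -/

/-! ### Cauchy–Binet, and spanning trees as sets of edges -/

section MatrixTree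

/-- The Cauchy–Binet formula for `A * Aᵀ`, summed over all maps into the set of columns. -/
theorem Matrix.factorial_mul_det_mul_transpose {m n R : Type*} [CommRing R] [Fintype m]
    [DecidableEq m] [Fintype n] (A : Matrix m n R) :
    ((Fintype.card m).factorial : R) * (A * A.transpose).det =
      ∑ f : m → n, (A.submatrix id f).det ^ 2 := by
  classical
  have expand : (A * A.transpose).det =
      ∑ f : m → n, (∏ i, A i (f i)) * (A.submatrix id f).det := by
    have h : (A * A.transpose) = fun i => ∑ j, A i j • A.transpose j := by
      ext i k
      simp [Matrix.mul_apply]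
    have h2 := (Matrix.detRowAlternating (n := m) (R := R)).toMultilinearMap.map_sum
      (fun i j => A i j • A.transpose j)
    change Matrix.det _ = ∑ f : m → n, Matrix.det _ at h2
    rw [h, h2]
    refine Finset.sum_congr rfl fun f _ => ?_
    have h3 := (Matrix.detRowAlternating (n := m) (R := R)).toMultilinearMap.map_smul_univ
      (fun i => A i (f i)) (fun i => A.transpose (f i))
    change Matrix.det _ = _ • Matrix.det _ at h3
    rw [h3, smul_eq_mul, ← Matrix.det_transpose (A.submatrix id f)]
    rfl
  -- Replacing f by f ∘ σ permutes the columns. Summing over all σ then makes the product of entries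
  -- into a second determinant, at the cost of the factorial.
  have permuted (σ : Equiv.Perm m) : (A * A.transpose).det =
      ∑ f : m → n, ((Equiv.Perm.sign σ : ℤ) : R) * (∏ i, A i (f (σ i))) *
        (A.submatrix id f).det := by
    rw [expand]
    refine (Fintype.sum_equiv (Equiv.arrowCongr σ.symm (Equiv.refl n)) _ _ fun f => ?_).symm
    have : (A.submatrix id (f ∘ σ)).det =
        ((Equiv.Perm.sign σ : ℤ) : R) * (A.submatrix id f).det :=
      Matrix.det_permute' σ (A.submatrix id f)
    change _ = (∏ i, A i (f (σ i))) * (A.submatrix id (f ∘ σ)).det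
    rw [this]
    ring
  calc ((Fintype.card m).factorial : R) * (A * A.transpose).det
      = ∑ _σ : Equiv.Perm m, (A * A.transpose).det := by
        rw [Finset.sum_const, Finset.card_univ, Fintype.card_perm, nsmul_eq_mul]
    _ = ∑ σ : Equiv.Perm m, ∑ f : m → n, ((Equiv.Perm.sign σ : ℤ) : R) *
        (∏ i, A i (f (σ i))) * (A.submatrix id f).det :=
        Finset.sum_congr rfl fun σ _ => permuted σ
    _ = ∑ f : m → n, (A.submatrix id f).det ^ 2 := by
        rw [Finset.sum_comm]
        refine Finset.sum_congr rfl fun f _ => ?_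
        rw [← Finset.sum_mul, sq, ← Matrix.det_transpose (A.submatrix id f), Matrix.det_apply']
        rfl

/-- A diagonal entry of the adjugate is the corresponding principal minor. -/
theorem Matrix.adjugate_apply_self {m R : Type*} [CommRing R] [Fintype m] [DecidableEq m]
    (M : Matrix m m R) (r : m) :
    M.adjugate r r =
      (M.submatrix (Subtype.val : {i // i ≠ r} → m) (Subtype.val : {i // i ≠ r} → m)).det := by
  rw [Matrix.adjugate_apply, Matrix.twoBlockTriangular_det' _ (fun i => i = r)]
  · have h1 : ((M.updateRow r (Pi.single r 1)).toSquareBlockProp fun i => i = r) = 1 := by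
      ext ⟨i, rfl⟩ ⟨j, rfl⟩
      simp [Matrix.toSquareBlockProp]
    rw [h1, @Matrix.det_one _ (_) (_) _ _, one_mul]
    congr 1
    ext ⟨i, hi⟩ j
    simp [Matrix.toSquareBlockProp, Matrix.updateRow_apply, hi]
  · rintro i rfl j hj
    simp [hj]

namespace Graph

variable {V E : Type*}

/-- The simple graph on `V` whose edges are the non-loops among the edges in `S`, where the edge
`e` has the ends `ends e`. -/
def spannedBy (ends : E → Sym2 V) (S : Set E) : SimpleGraph V :=
  SimpleGraph.fromEdgeSet (ends '' S)

theorem edgeSet_spannedBy_subset (ends : E → Sym2 V) (S : Set E) :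
    (spannedBy ends S).edgeSet ⊆ ends '' S := by
  simp [spannedBy, SimpleGraph.edgeSet_fromEdgeSet]

theorem card_le_ncard_of_spannedBy_connected [Finite V] [Finite E] {ends : E → Sym2 V} {S : Set E}
    (h : (spannedBy ends S).Connected) : Nat.card V ≤ S.ncard + 1 := by
  have h1 := h.card_vert_le_card_edgeSet_add_one
  have h2 := Set.ncard_le_ncard (edgeSet_spannedBy_subset ends S) (Set.toFinite _)
  have h3 := Set.ncard_image_le (f := ends) (Set.toFinite S)
  rw [Nat.card_coe_set_eq] at h1
  omega

/-- A connected simple graph on V needs at least |V| - 1 edges. If |V| - 1 labelled edges already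
connect V, none can be wasted on a loop or a parallel edge. -/
theorem isTree_iff_spannedBy [Finite V] [Finite E] {G : Graph V E} {ends : E → Sym2 V}
    (hV : G.vertexSet = Set.univ)
    (hends : ∀ e ∈ G.edgeSet, ∀ x y, G.IsLink e x y ↔ s(x, y) = ends e) :
    G.IsTree ↔ (spannedBy ends G.edgeSet).Connected ∧ G.edgeSet.ncard + 1 = Nat.card V := by
  have hadj (x y : V) : G.Adj x y ↔ s(x, y) ∈ ends '' G.edgeSet := by
    constructor
    · rintro ⟨e, he⟩
      exact ⟨e, he.edge_mem, ((hends e he.edge_mem x y).1 he).symm⟩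
    · rintro ⟨e, he, h⟩
      exact ⟨e, (hends e he x y).2 h.symm⟩
  have iso : G.toSimpleGraph ≃g spannedBy ends G.edgeSet :=
    { toEquiv := (Equiv.setCongr hV).trans (Equiv.Set.univ V)
      map_rel_iff' := by
        rintro ⟨x, hx⟩ ⟨y, hy⟩
        simp [spannedBy, hadj, and_comm] }
  have htree : G.toSimpleGraph.IsTree ↔ (spannedBy ends G.edgeSet).IsTree := iso.isTree_iff
  rw [Graph.IsTree, htree, SimpleGraph.isTree_iff_connected_and_card, Nat.card_coe_set_eq]
  have hsub := edgeSet_spannedBy_subset ends G.edgeSet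
  constructor
  · rintro ⟨hs, hc, hcard⟩
    refine ⟨hc, ?_⟩
    have himg : (spannedBy ends G.edgeSet).edgeSet = ends '' G.edgeSet := by
      refine hsub.antisymm ?_
      rintro _ ⟨e, he, rfl⟩
      simp only [spannedBy, SimpleGraph.edgeSet_fromEdgeSet]
      refine ⟨⟨e, he, rfl⟩, ?_⟩
      obtain ⟨x, y, hxy⟩ := exists_isLink_of_mem_edgeSet he
      rw [← (hends e he x y).1 hxy]
      simpa using hxy.ne
    have hinj : Set.InjOn ends G.edgeSet := by
      intro e he f hf hef
      obtain ⟨x, y, hxy⟩ := exists_isLink_of_mem_edgeSet he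
      refine hs.eq_of_isLink hxy ((hends f hf x y).2 ?_)
      rw [← hef, (hends e he x y).1 hxy]
    rw [← hcard, himg, hinj.ncard_image]
  · rintro ⟨hc, hcard⟩
    have h1 := hc.card_vert_le_card_edgeSet_add_one
    have h2 := Set.ncard_le_ncard hsub (Set.toFinite _)
    have h3 := Set.ncard_image_le (f := ends) (Set.toFinite G.edgeSet)
    rw [Nat.card_coe_set_eq] at h1
    have himg : (spannedBy ends G.edgeSet).edgeSet = ends '' G.edgeSet :=
      Set.eq_of_subset_of_ncard_le hsub (by omega) (Set.toFinite _)
    have hinj : Set.InjOn ends G.edgeSet :=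
      Set.injOn_of_ncard_image_eq (by omega) (Set.toFinite _)
    refine ⟨{ not_isLoopAt := fun e x hx => ?_, eq_of_isLink := fun e f x y he hf => ?_ },
      hc, by omega⟩
    · have hx : G.IsLink e x x := hx
      have : s(x, x) ∈ (spannedBy ends G.edgeSet).edgeSet := by
        rw [himg]
        exact ⟨e, hx.edge_mem, ((hends e hx.edge_mem x x).1 hx).symm⟩
      simp at this
    · exact hinj he.edge_mem hf.edge_mem
        (((hends e he.edge_mem x y).1 he).symm.trans ((hends f hf.edge_mem x y).1 hf))

theorem numSpanningTrees_eq_ncard_spannedBy [Finite V] [Finite E] {G : Graph V E}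
    {ends : E → Sym2 V}
    (hV : G.vertexSet = Set.univ) (hE : G.edgeSet = Set.univ)
    (hends : ∀ e x y, G.IsLink e x y ↔ s(x, y) = ends e) :
    G.numSpanningTrees =
      {S : Set E | (spannedBy ends S).Connected ∧ S.ncard + 1 = Nat.card V}.ncard := by
  rw [numSpanningTrees]
  have key (T : Graph V E) (hT : T ≤s G) : T.IsTree ↔
      (spannedBy ends T.edgeSet).Connected ∧ T.edgeSet.ncard + 1 = Nat.card V :=
    isTree_iff_spannedBy (hT.vertexSet_eq.trans hV) fun e he x y => by
      rw [hT.le.isLink_iff he, hends]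
  refine Set.ncard_congr (fun T _ => T.edgeSet) ?_ ?_ ?_
  · rintro T ⟨hT, h⟩
    exact (key T hT).1 h
  · rintro T T' ⟨hT, -⟩ ⟨hT', -⟩ h
    exact Graph.Compatible.ext (hT.vertexSet_eq.trans hT'.vertexSet_eq.symm) h
      (Graph.Compatible.of_le_le hT.le hT'.le)
  · intro S hS
    have hr : (G.restrict S).edgeSet = S := by simp [hE]
    refine ⟨G.restrict S, ⟨⟨restrict_le, by simp⟩, ?_⟩, hr⟩
    rw [key _ ⟨restrict_le, by simp⟩, hr]
    exact hS

end Graph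
end MatrixTree

/-! ### Unimodularity of the incidence matrix and the matrix-tree theorem -/

section Incidence

/-- The oriented incidence matrix of the edges directed from `src e` to `tgt e`. -/
def incidence {V E : Type*} [DecidableEq V] (src tgt : E → V) : Matrix V E ℤ :=
  Matrix.of fun v e => (if v = src e then 1 else 0) - (if v = tgt e then 1 else 0)

variable {V E : Type*} [DecidableEq V] [Fintype V] {src tgt : E → V}

/-- A square matrix of columns of the reduced incidence matrix is unimodular if the corresponding
edges connect the graph. -/
theorem det_incidence_sq_eq_one {r : V} {f : {v // v ≠ r} → E}
    (h : (Graph.spannedBy (fun e => s(src e, tgt e)) (Set.range f)).Connected) :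
    ((incidence src tgt).submatrix (Subtype.val : {v // v ≠ r} → V) f).det ^ 2 = 1 := by
  set A := (incidence src tgt).submatrix (Subtype.val : {v // v ≠ r} → V) f with hA
  -- the reduced basis vectors
  let b : V → {v // v ≠ r} → ℤ := fun w v => if v.1 = w then 1 else 0
  have hcol (i) : A.mulVec (Pi.single i 1) = b (src (f i)) - b (tgt (f i)) := by
    ext v
    simp [hA, incidence, b]
  -- Differences of basis vectors telescope along a walk. Since `b r = 0`, a walk to `r` puts each
  -- basis vector in the integer column span, so A has an integer inverse.
  have hwalk {u w : V} (p : (Graph.spannedBy (fun e => s(src e, tgt e)) (Set.range f)).Walk u w) :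
      b u - b w ∈ LinearMap.range A.mulVecLin := by
    induction p with
    | nil => simp
    | cons hadj _ ih =>
      rename_i u v w _
      rw [← sub_add_sub_cancel (b u) (b v) (b w)]
      refine add_mem ?_ ih
      simp only [Graph.spannedBy, SimpleGraph.fromEdgeSet_adj] at hadj
      obtain ⟨⟨_, ⟨i, rfl⟩, hi⟩, -⟩ := hadj
      have hmem : b (src (f i)) - b (tgt (f i)) ∈ LinearMap.range A.mulVecLin :=
        ⟨Pi.single i 1, hcol i⟩
      rcases Sym2.eq_iff.1 hi with ⟨rfl, rfl⟩ | ⟨rfl, rfl⟩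
      · exact hmem
      · rw [← neg_sub]
        exact neg_mem hmem
  have hb : ∀ w, b w ∈ LinearMap.range A.mulVecLin := by
    intro w
    obtain ⟨p⟩ := h.preconnected w r
    have hr : b r = 0 := by
      ext v
      simp [b, v.2]
    simpa [hr] using hwalk p
  choose x hx using hb
  have hinv : A * Matrix.of (fun i (v : {v // v ≠ r}) => x v.1 i) = 1 := by
    ext v w
    have := congrFun (hx w.1) v
    simp only [Matrix.mulVecLin_apply, Matrix.mulVec, dotProduct, b] at this
    rw [Matrix.mul_apply, Matrix.one_apply]
    simpa [Subtype.ext_iff] using this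
  have hdet := congrArg Matrix.det hinv
  rw [Matrix.det_mul, Matrix.det_one] at hdet
  exact Int.isUnit_sq (IsUnit.of_mul_eq_one _ hdet)

theorem det_incidence_eq_zero {r : V} {f : {v // v ≠ r} → E}
    (h : ¬ (Graph.spannedBy (fun e => s(src e, tgt e)) (Set.range f)).Connected) :
    ((incidence src tgt).submatrix (Subtype.val : {v // v ≠ r} → V) f).det = 0 := by
  classical
  set H := Graph.spannedBy (fun e => s(src e, tgt e)) (Set.range f) with hH
  obtain ⟨u, hu⟩ : ∃ u, ¬ H.Reachable u r := by
    by_contra! hall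
    exact h ((SimpleGraph.connected_iff _).2 ⟨fun a b => (hall a).trans (hall b).symm, ⟨r⟩⟩)
  have hur : u ≠ r := fun hh => hu (hh ▸ SimpleGraph.Reachable.refl _)
  -- The indicator of the vertices not reachable from `r` is a nonzero left null vector: no chosen
  -- edge leaves a component, and `r` itself has value 0.
  refine Matrix.exists_vecMul_eq_zero_iff.1
    ⟨fun v => if H.Reachable v.1 r then 0 else 1, fun h0 => ?_, ?_⟩
  · simpa [hu] using congrFun h0 ⟨u, hur⟩
  · ext i
    have hiff : H.Reachable (src (f i)) r ↔ H.Reachable (tgt (f i)) r := by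
      by_cases hst : src (f i) = tgt (f i)
      · rw [hst]
      · have hadj : H.Adj (src (f i)) (tgt (f i)) := by
          simp only [hH, Graph.spannedBy, SimpleGraph.fromEdgeSet_adj]
          exact ⟨⟨f i, ⟨i, rfl⟩, rfl⟩, hst⟩
        exact ⟨fun hh => hadj.symm.reachable.trans hh, fun hh => hadj.reachable.trans hh⟩
    have hsum (w : V) : ∑ v : {v // v ≠ r}, (if H.Reachable v.1 r then (0 : ℤ) else 1) *
        (if v.1 = w then 1 else 0) = if H.Reachable w r then 0 else 1 := by
      by_cases hw : w = r
      · subst hw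
        rw [if_pos (SimpleGraph.Reachable.refl _)]
        exact Finset.sum_eq_zero fun v _ => by simp [v.2]
      · rw [Finset.sum_eq_single ⟨w, hw⟩]
        · simp
        · intro v _ hv
          rw [if_neg (fun hh => hv (Subtype.ext hh)), mul_zero]
        · simp
    simp only [Matrix.vecMul, dotProduct, Matrix.submatrix_apply, incidence, Matrix.of_apply,
      mul_sub, Finset.sum_sub_distrib, hsum, Pi.zero_apply]
    simp [hiff]

/-- Such maps are bijections onto S. This count cancels the factorial in the Cauchy–Binet formula.
-/
theorem card_range_eq {m E : Type*} [Fintype m] [DecidableEq m] [Fintype E] [DecidableEq E]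
    (S : Set E) (hS : S.ncard = Fintype.card m) [DecidablePred fun f : m → E => Set.range f = S] :
    (Finset.univ.filter fun f : m → E => Set.range f = S).card = (Fintype.card m).factorial := by
  classical
  have hS' : Fintype.card m = Fintype.card S := by
    rw [← hS, Set.ncard_eq_toFinset_card', Set.toFinset_card]
  have e : {f : m → E // Set.range f = S} ≃ (m ≃ S) :=
    { toFun := fun f => Equiv.ofBijective (fun i => (⟨f.1 i, f.2.le ⟨i, rfl⟩⟩ : S))
        ((Fintype.bijective_iff_surjective_and_card _).2 ⟨by
          rintro ⟨e, he⟩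
          rw [← f.2] at he
          obtain ⟨i, rfl⟩ := he
          exact ⟨i, rfl⟩, hS'⟩)
      invFun := fun g => ⟨fun i => g i, by
        ext e
        refine ⟨?_, fun he => ⟨g.symm ⟨e, he⟩, by simp⟩⟩
        rintro ⟨i, rfl⟩
        exact (g i).2⟩
      left_inv := fun f => rfl
      right_inv := fun g => by ext i; rfl }
  rw [← Fintype.card_subtype, Fintype.card_congr e, Fintype.card_equiv (Fintype.equivOfCardEq hS')]

/-- The matrix-tree theorem: the principal cofactors of the Laplacian count the spanning trees. -/
theorem adjugate_laplacian_eq_numSpanningTrees [Fintype E] {G : Graph V E}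
    (hV : G.vertexSet = Set.univ) (hE : G.edgeSet = Set.univ)
    (hG : ∀ e x y, G.IsLink e x y ↔ s(x, y) = s(src e, tgt e)) (r : V) :
    (incidence src tgt * (incidence src tgt).transpose).adjugate r r = G.numSpanningTrees := by
  classical
  rw [Graph.numSpanningTrees_eq_ncard_spannedBy hV hE hG]
  set C : Set E → Prop := fun S => (Graph.spannedBy (fun e => s(src e, tgt e)) S).Connected
  set A := (incidence src tgt).submatrix (Subtype.val : {v // v ≠ r} → V) id with hA
  have hcardV : Fintype.card {v // v ≠ r} + 1 = Nat.card V := by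
    have := Fintype.card_pos_iff.2 ⟨r⟩
    simp [Fintype.card_subtype_compl]
    omega
  have hadj : (incidence src tgt * (incidence src tgt).transpose).adjugate r r =
      (A * A.transpose).det := by
    rw [Matrix.adjugate_apply_self]
    rfl
  have hsum : ∑ f : {v // v ≠ r} → E, (A.submatrix id f).det ^ 2 =
      ((Finset.univ.filter fun f : {v // v ≠ r} → E => C (Set.range f)).card : ℤ) := by
    rw [Finset.card_filter, Nat.cast_sum]
    refine Finset.sum_congr rfl fun f _ => ?_
    split_ifs with hf
    · exact det_incidence_sq_eq_one hf
    · have := det_incidence_eq_zero hf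
      simp only [Nat.cast_zero]
      rw [show A.submatrix id f = (incidence src tgt).submatrix Subtype.val f from rfl, this]
      simp
  have hcount : (Finset.univ.filter fun f : {v // v ≠ r} → E => C (Set.range f)).card =
      (Fintype.card {v // v ≠ r}).factorial *
        {S : Set E | C S ∧ S.ncard + 1 = Nat.card V}.ncard := by
    rw [Set.ncard_eq_toFinset_card', mul_comm]
    have hmaps : ∀ f ∈ Finset.univ.filter fun f : {v // v ≠ r} → E => C (Set.range f),
        Set.range f ∈ {S : Set E | C S ∧ S.ncard + 1 = Nat.card V}.toFinset := by
      intro f hf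
      have hf : C (Set.range f) := (Finset.mem_filter.1 hf).2
      rw [Set.mem_toFinset]
      have h1 := Graph.card_le_ncard_of_spannedBy_connected hf
      have h2 := Set.ncard_image_le (f := f) (Set.toFinite Set.univ)
      rw [Set.image_univ, Set.ncard_univ, Nat.card_eq_fintype_card] at h2
      exact ⟨hf, by omega⟩
    rw [Finset.card_eq_sum_card_fiberwise hmaps]
    refine Finset.sum_const_nat fun S hS => ?_
    obtain ⟨hC, hS⟩ : C S ∧ S.ncard + 1 = Nat.card V := by simpa using hS
    rw [← card_range_eq S (by omega : S.ncard = Fintype.card {v // v ≠ r}), Finset.filter_filter]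
    congr 1
    ext f
    simp only [Finset.mem_filter, Finset.mem_univ, true_and, and_iff_right_iff_imp]
    rintro rfl
    exact hC
  have hfac := Matrix.factorial_mul_det_mul_transpose A
  rw [hsum, hcount, Nat.cast_mul] at hfac
  rw [hadj]
  exact mul_left_cancel₀ (by exact_mod_cast Nat.factorial_ne_zero _) hfac

end Incidence

/-! ### Fourier diagonalisation of the circulant Laplacian -/

section Spectrum

theorem ZMod.sum_eq_sum_range {M : Type*} [AddCommMonoid M] (N : ℕ) [NeZero N] (g : ZMod N → M) :
    ∑ x, g x = ∑ i ∈ Finset.range N, g (i : ZMod N) := by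
  refine Finset.sum_nbij' (fun x => x.val) (fun i => (i : ZMod N)) ?_ ?_ ?_ ?_ ?_
  · intro x _
    simpa using x.val_lt
  · simp
  · simp
  · intro i hi
    exact ZMod.val_cast_of_lt (Finset.mem_range.1 hi)
  · simp

/-- Needed for the edges from i to i + n, which are indexed by only half of the vertices. -/
theorem ZMod.two_mul_sum_fin (n : ℕ) [NeZero n] (g : ZMod (2 * n) → ℂ)
    (hg : ∀ x, g (x + n) = g x) :
    2 * ∑ i : Fin n, g ((i : ℕ) : ZMod (2 * n)) = ∑ x, g x := by
  have hsplit (f : ℕ → ℂ) : ∑ i ∈ Finset.range (2 * n), f i =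
      ∑ i ∈ Finset.range n, f i + ∑ i ∈ Finset.range n, f (n + i) := by
    rw [two_mul n, Finset.sum_range_add]
  rw [ZMod.sum_eq_sum_range, hsplit, Fin.sum_univ_eq_sum_range (fun i => g (i : ZMod (2 * n))),
    two_mul]
  congr 1
  refine Finset.sum_congr rfl fun i _ => ?_
  rw [Nat.cast_add, add_comm, hg]

/-- Principal cofactors of a matrix on `ZMod N` diagonalised by the discrete Fourier transform. -/
theorem adjugate_zero_zero_of_dft {N : ℕ} [NeZero N] (L : Matrix (ZMod N) (ZMod N) ℂ)
    (ev : ZMod N → ℂ) (h0 : ev 0 = 0)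
    (h : ∀ v m, ∑ w, L v w * ZMod.stdAddChar (w * m) = ev m * ZMod.stdAddChar (v * m)) :
    (N : ℂ) * L.adjugate 0 0 = ∏ m ∈ Finset.univ.erase 0, ev m := by
  let U : Matrix (ZMod N) (ZMod N) ℂ := Matrix.of fun v m => ZMod.stdAddChar (v * m)
  let W : Matrix (ZMod N) (ZMod N) ℂ := Matrix.of fun m v => ZMod.stdAddChar (-(m * v))
  have hN : (N : ℂ) ≠ 0 := Nat.cast_ne_zero.2 (NeZero.ne N)
  have hLU : L * U = U * Matrix.diagonal ev := by
    ext v m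
    rw [Matrix.mul_apply, Matrix.mul_diagonal]
    exact (h v m).trans (mul_comm _ _)
  -- Orthogonality of characters.
  have hUW : U * W = (N : ℂ) • 1 := by
    ext v w
    rw [Matrix.mul_apply]
    have := AddChar.sum_mulShift (v - w) (ZMod.isPrimitive_stdAddChar N)
    simp only [ZMod.card] at this
    simp only [U, W, Matrix.of_apply, ← AddChar.map_add_eq_mul, Matrix.smul_apply, Matrix.one_apply,
      smul_eq_mul, mul_ite, mul_one, mul_zero]
    calc _ = ∑ x, ZMod.stdAddChar (N := N) (x * (v - w)) := by
          refine Finset.sum_congr rfl fun x _ => ?_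
          congr 1
          ring
      _ = _ := by rw [this]; simp [sub_eq_zero]
  have hdet : U.det ≠ 0 := by
    intro hU
    have := congrArg Matrix.det hUW
    rw [Matrix.det_mul, hU, zero_mul, Matrix.det_smul, Matrix.det_one, mul_one] at this
    exact pow_ne_zero _ hN this.symm
  have hadjU : (N : ℂ) • U.adjugate = U.det • W := by
    have : U.adjugate * (U * W) = U.det • W := by
      rw [← Matrix.mul_assoc, Matrix.adjugate_mul, Matrix.smul_mul, Matrix.one_mul]
    rwa [hUW, Matrix.mul_smul, Matrix.mul_one] at this
  have hadj : U.adjugate * L.adjugate = (Matrix.diagonal ev).adjugate * U.adjugate := by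
    rw [← Matrix.adjugate_mul_distrib, ← Matrix.adjugate_mul_distrib, hLU]
  have hW : W * L.adjugate = (Matrix.diagonal ev).adjugate * W := by
    have h1 := congrArg (fun M => (N : ℂ) • M) hadj
    beta_reduce at h1
    rw [← Matrix.smul_mul, ← Matrix.mul_smul, hadjU, Matrix.smul_mul, Matrix.mul_smul] at h1
    exact smul_right_injective _ hdet h1
  have hfin : (N : ℂ) • L.adjugate = U * (Matrix.diagonal ev).adjugate * W := by
    rw [Matrix.mul_assoc, ← hW, ← Matrix.mul_assoc, hUW, Matrix.smul_mul, Matrix.one_mul]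
  have h00 := congrFun (congrFun hfin 0) 0
  rw [Matrix.adjugate_diagonal, Matrix.mul_apply] at h00
  simp only [Matrix.smul_apply, smul_eq_mul, Matrix.mul_diagonal] at h00
  -- Off index 0, each diagonal entry of the adjugate of `diagonal ev` contains the factor `ev 0 =
  -- 0`.
  rw [h00, Finset.sum_eq_single 0]
  · simp [U, W]
  · intro m _ hm
    rw [Finset.prod_eq_zero (Finset.mem_erase.2 ⟨hm.symm, Finset.mem_univ _⟩) h0]
    simp
  · simp

variable {k : ℕ}

/-- The eigenvalues of the Laplacian of `oddCirculant n s`. -/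
noncomputable def circulantEigenvalue (n : ℕ) [NeZero n] (s : Fin k → ℕ) (m : ZMod (2 * n)) : ℂ :=
  ∑ j, (2 - ZMod.stdAddChar ((s j : ZMod (2 * n)) * m) -
    ZMod.stdAddChar (-((s j : ZMod (2 * n)) * m))) + (1 - ZMod.stdAddChar ((n : ZMod (2 * n)) * m))

theorem mul_numSpanningTrees_oddCirculant (n : ℕ) [NeZero n] (s : Fin k → ℕ) :
    ((2 * n : ℕ) : ℂ) * (oddCirculant n s).numSpanningTrees =
      ∏ m ∈ Finset.univ.erase 0, circulantEigenvalue n s m := by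
  let src : (ZMod (2 * n) × Fin k) ⊕ Fin n → ZMod (2 * n) :=
    Sum.elim (fun p => p.1) (fun i => ((i : ℕ) : ZMod (2 * n)))
  let tgt : (ZMod (2 * n) × Fin k) ⊕ Fin n → ZMod (2 * n) :=
    Sum.elim (fun p => p.1 + (s p.2 : ZMod (2 * n)))
      (fun i => ((i : ℕ) : ZMod (2 * n)) + (n : ZMod (2 * n)))
  have htree := adjugate_laplacian_eq_numSpanningTrees (G := oddCirculant n s) (src := src)
    (tgt := tgt) rfl rfl (by rintro (⟨i, j⟩ | i) x y <;> rfl) 0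
  set D := incidence src tgt with hD
  have hcast : ((oddCirculant n s).numSpanningTrees : ℂ) =
      ((Int.castRingHom ℂ).mapMatrix (D * D.transpose)).adjugate 0 0 := by
    rw [← RingHom.map_adjugate, RingHom.mapMatrix_apply, Matrix.map_apply, htree]
    simp
  rw [hcast]
  refine adjugate_zero_zero_of_dft _ _ (by simp [circulantEigenvalue]; ring) fun v m => ?_
  set χ : ZMod (2 * n) → ℂ := fun x => ZMod.stdAddChar (x * m) with hχ
  have hχadd (x y : ZMod (2 * n)) : χ (x + y) = χ x * χ y := by
    simp [hχ, add_mul, AddChar.map_add_eq_mul]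
  have hnn : ((n : ZMod (2 * n)) + n) = 0 := by
    rw [← two_mul]
    exact_mod_cast ZMod.natCast_self (2 * n)
  have hinner (e) : ∑ w, ((D w e : ℤ) : ℂ) * χ w = χ (src e) - χ (tgt e) := by
    simp [hD, incidence, sub_mul, Finset.sum_sub_distrib]
  have hL : ∑ w, ((Int.castRingHom ℂ).mapMatrix (D * D.transpose)) v w * χ w =
      ∑ e, (D v e : ℂ) * (χ (src e) - χ (tgt e)) := by
    simp only [← hinner, Finset.mul_sum]
    rw [Finset.sum_comm]
    refine Finset.sum_congr rfl fun w _ => ?_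
    simp only [RingHom.mapMatrix_apply, Matrix.map_apply, Matrix.mul_apply, map_sum, map_mul,
      Finset.sum_mul, mul_assoc, Matrix.transpose_apply, eq_intCast]
  refine hL.trans ?_
  have hDv (e) : (D v e : ℂ) = (if v = src e then 1 else 0) - (if v = tgt e then 1 else 0) := by
    simp [hD, incidence]
  have hfin : ∑ i : Fin n, (D v (.inr i) : ℂ) * (χ (src (.inr i)) - χ (tgt (.inr i))) =
      χ v - χ (v + n) := by
    let g : ZMod (2 * n) → ℂ := fun x =>
      ((if v = x then 1 else 0) - (if v = x + n then 1 else 0)) * (χ x - χ (x + n))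
    have hg : ∀ x, g (x + n) = g x := by
      intro x
      simp only [g, add_assoc, hnn, add_zero]
      ring
    have hsum : ∑ x, g x = 2 * (χ v - χ (v + n)) := by
      have h2 (x : ZMod (2 * n)) : v = x + n ↔ v + n = x := by
        constructor
        · rintro rfl
          rw [add_assoc, hnn, add_zero]
        · rintro rfl
          rw [add_assoc, hnn, add_zero]
      simp only [g, sub_mul, Finset.sum_sub_distrib, h2, ite_mul, one_mul, zero_mul,
        Finset.sum_ite_eq, Finset.mem_univ, if_true, add_assoc, hnn, add_zero]
      ring
    have := ZMod.two_mul_sum_fin n g hg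
    rw [hsum] at this
    rw [← mul_left_cancel₀ two_ne_zero this]
    refine Finset.sum_congr rfl fun i _ => ?_
    rw [hDv]
    rfl
  have hpair (j : Fin k) : ∑ i : ZMod (2 * n),
      (D v (.inl (i, j)) : ℂ) * (χ (src (.inl (i, j))) - χ (tgt (.inl (i, j)))) =
      2 * χ v - χ (v + s j) - χ (v - s j) := by
    have h2 (x : ZMod (2 * n)) : v = x + s j ↔ v - s j = x := sub_eq_iff_eq_add.symm
    have hterm (i : ZMod (2 * n)) :
        (D v (.inl (i, j)) : ℂ) * (χ (src (.inl (i, j))) - χ (tgt (.inl (i, j)))) =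
        ((if v = i then 1 else 0) - (if v = i + s j then 1 else 0)) * (χ i - χ (i + s j)) := by
      rw [hDv]
      rfl
    simp only [hterm, sub_mul, Finset.sum_sub_distrib, h2, ite_mul, one_mul, zero_mul,
      Finset.sum_ite_eq, Finset.mem_univ, if_true, sub_add_cancel]
    ring
  rw [Fintype.sum_sum_type, hfin, Fintype.sum_prod_type_right]
  simp only [hpair, circulantEigenvalue]
  rw [add_mul, Finset.sum_mul]
  congr 1
  · refine Finset.sum_congr rfl fun j _ => ?_
    rw [sub_eq_add_neg v, hχadd, hχadd]
    simp only [hχ, neg_mul]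
    ring
  · rw [hχadd]
    simp only [hχ]
    ring

end Spectrum

/-! ### Products over the n-th roots of 1 and -1 -/

section RootsOfUnity

open Polynomial

theorem prod_nthRootsFinset_sub {n : ℕ} (hn : 0 < n) {a : ℂ} (ha : a ≠ 0) (z : ℂ) :
    ∏ w ∈ nthRootsFinset n a, (z - w) = z ^ n - a := by
  have hroots := (IsAlgClosed.splits (X ^ n - C a : ℂ[X])).eq_prod_roots_of_monic
    (monic_X_pow_sub_C a hn.ne')
  have hnodup := (Complex.isPrimitiveRoot_exp n hn.ne').nthRoots_nodup ha
  have h := congrArg (eval z) hroots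
  rw [eval_multiset_prod, Multiset.map_map] at h
  simp only [Function.comp_def, eval_sub, eval_pow, eval_X, eval_C] at h
  rw [h, nthRootsFinset, ← Multiset.toFinset_eq hnodup]
  rfl

theorem card_nthRootsFinset_complex {n : ℕ} (hn : 0 < n) {a : ℂ} (ha : a ≠ 0) :
    (nthRootsFinset n a).card = n := by
  have hp := Complex.isPrimitiveRoot_exp n hn.ne'
  rw [nthRootsFinset, ← Multiset.toFinset_eq (hp.nthRoots_nodup ha)]
  obtain ⟨α, hα⟩ := IsAlgClosed.exists_pow_nat_eq a hn
  have := hp.card_nthRoots a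
  rwa [if_pos ⟨α, hα⟩] at this

theorem inv_mem_nthRootsFinset {n : ℕ} (hn : 0 < n) {a : ℂ} (ha : a⁻¹ = a) {w : ℂ}
    (hw : w ∈ nthRootsFinset n a) : w⁻¹ ∈ nthRootsFinset n a := by
  rw [mem_nthRootsFinset hn] at hw ⊢
  rw [inv_pow, hw, ha]

theorem prod_nthRootsFinset_inv {n : ℕ} (hn : 0 < n) {a : ℂ} (ha : a⁻¹ = a) (f : ℂ → ℂ) :
    ∏ w ∈ nthRootsFinset n a, f w⁻¹ = ∏ w ∈ nthRootsFinset n a, f w :=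
  Finset.prod_nbij' (·⁻¹) (·⁻¹) (fun _ h => inv_mem_nthRootsFinset hn ha h)
    (fun _ h => inv_mem_nthRootsFinset hn ha h) (by simp) (by simp) (by simp)

/-- Each factor is -z⁻¹(z - w)(z - w⁻¹), and inversion permutes the roots because a = ±1, so the
product is (-1)ⁿz⁻ⁿ(zⁿ - a)². -/
theorem prod_nthRootsFinset_add_inv_sub {n : ℕ} (hn : 0 < n) {a : ℂ} (ha : a ^ 2 = 1) (z : ℂˣ) :
    ∏ w ∈ nthRootsFinset n a, (w + w⁻¹ - (z + (z⁻¹ : ℂˣ))) =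
      (-1) ^ n * ((z : ℂ) ^ n + ((z⁻¹ : ℂˣ) : ℂ) ^ n - 2 * a) := by
  have ha0 : a ≠ 0 := by
    rintro rfl
    simp at ha
  have hainv : a⁻¹ = a := by
    field_simp
    exact ha.symm
  have hterm : ∀ w ∈ nthRootsFinset n a, w + w⁻¹ - (z + (z⁻¹ : ℂˣ)) =
      -((z⁻¹ : ℂˣ) : ℂ) * ((z - w) * (z - w⁻¹)) := by
    intro w hw
    have hw0 : w ≠ 0 := by
      rintro rfl
      rw [mem_nthRootsFinset hn, zero_pow hn.ne'] at hw
      exact ha0 hw.symm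
    have hz := z.ne_zero
    rw [Units.val_inv_eq_inv_val]
    field_simp
    ring
  have hz : (z : ℂ) ^ n * ((z⁻¹ : ℂˣ) : ℂ) ^ n = 1 := by
    rw [← mul_pow, Units.mul_inv, one_pow]
  rw [Finset.prod_congr rfl hterm, Finset.prod_mul_distrib, Finset.prod_const,
    card_nthRootsFinset_complex hn ha0, Finset.prod_mul_distrib,
    prod_nthRootsFinset_inv hn hainv (fun w => (z : ℂ) - w), prod_nthRootsFinset_sub hn ha0,
    neg_pow]
  linear_combination (-1) ^ n * ((z : ℂ) ^ n - 2 * a) * hz + (-1) ^ n * ((z⁻¹ : ℂˣ) : ℂ) ^ n * ha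

theorem one_mem_nthRootsFinset_one {n : ℕ} (hn : 0 < n) : (1 : ℂ) ∈ nthRootsFinset n (1 : ℂ) := by
  rw [mem_nthRootsFinset hn, one_pow]

theorem prod_nthRootsFinset_erase_one_add_inv_sub {n : ℕ} (hn : 0 < n) (z : ℂˣ)
    (hz : (z + (z⁻¹ : ℂˣ) : ℂ) ≠ 2) :
    ∏ w ∈ (nthRootsFinset n (1 : ℂ)).erase 1, (w + w⁻¹ - (z + (z⁻¹ : ℂˣ))) =
      (2 - (z + (z⁻¹ : ℂˣ) : ℂ))⁻¹ *
        ((-1) ^ n * ((z : ℂ) ^ n + ((z⁻¹ : ℂˣ) : ℂ) ^ n - 2)) := by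
  have h := prod_nthRootsFinset_add_inv_sub hn (one_pow 2) z
  rw [← Finset.mul_prod_erase _ _ (one_mem_nthRootsFinset_one hn), mul_one] at h
  rw [← h, inv_one, one_add_one_eq_two, inv_mul_cancel_left₀ (sub_ne_zero.2 hz.symm)]

theorem prod_nthRootsFinset_erase_one_one_sub {n : ℕ} (hn : 0 < n) :
    ∏ w ∈ (nthRootsFinset n (1 : ℂ)).erase 1, (1 - w) = n := by
  have hpoly : ∏ w ∈ (nthRootsFinset n (1 : ℂ)).erase 1, (X - C w) =
      ∑ i ∈ Finset.range n, (X : ℂ[X]) ^ i := by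
    have h := X_pow_sub_one_eq_prod hn (Complex.isPrimitiveRoot_exp n hn.ne')
    rw [← Finset.mul_prod_erase _ _ (one_mem_nthRootsFinset_one hn), ← mul_geom_sum, C_1] at h
    exact (mul_left_cancel₀ (X_sub_C_ne_zero (1 : ℂ)) h).symm
  have h := congrArg (eval 1) hpoly
  simpa [eval_prod, eval_finsetSum] using h

/-- The degenerate case z = 1, where the factor at w = 1 vanishes and must be left out. Each
remaining factor is -(1 - w)(1 - w⁻¹), and the product of the 1 - w is 1 + 1 + ⋯ + 1 = n. -/
theorem prod_nthRootsFinset_erase_one_add_inv_sub_two {n : ℕ} (hn : 0 < n) :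
    ∏ w ∈ (nthRootsFinset n (1 : ℂ)).erase 1, (w + w⁻¹ - 2) = (-1) ^ (n - 1) * (n : ℂ) ^ 2 := by
  have hterm : ∀ w ∈ (nthRootsFinset n (1 : ℂ)).erase 1, w + w⁻¹ - 2 =
      -1 * ((1 - w) * (1 - w⁻¹)) := by
    intro w hw
    have hw0 : w ≠ 0 := by
      rintro rfl
      have := (Finset.mem_erase.1 hw).2
      rw [mem_nthRootsFinset hn, zero_pow hn.ne'] at this
      exact zero_ne_one this
    field_simp
    ring
  have hinv : ∏ w ∈ (nthRootsFinset n (1 : ℂ)).erase 1, (1 - w⁻¹) =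
      ∏ w ∈ (nthRootsFinset n (1 : ℂ)).erase 1, (1 - w) := by
    have hmem : ∀ w ∈ (nthRootsFinset n (1 : ℂ)).erase 1,
        w⁻¹ ∈ (nthRootsFinset n (1 : ℂ)).erase 1 := fun w hw =>
      Finset.mem_erase.2 ⟨inv_ne_one.2 (Finset.mem_erase.1 hw).1,
        inv_mem_nthRootsFinset hn inv_one (Finset.mem_erase.1 hw).2⟩
    exact Finset.prod_nbij' (·⁻¹) (·⁻¹) hmem hmem (by simp) (by simp) (by simp)
  rw [Finset.prod_congr rfl hterm, Finset.prod_mul_distrib, Finset.prod_const,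
    Finset.card_erase_of_mem (one_mem_nthRootsFinset_one hn),
    card_nthRootsFinset_complex hn one_ne_zero, Finset.prod_mul_distrib, hinv,
    prod_nthRootsFinset_erase_one_one_sub hn, sq]

/-- The nontrivial `2 * n`-th roots of unity are the nontrivial `n`-th roots of `1` and the `n`-th
roots of `-1`. -/
theorem prod_stdAddChar_erase_zero (n : ℕ) [NeZero n] (f : ℂ → ℂ) :
    ∏ m ∈ Finset.univ.erase (0 : ZMod (2 * n)), f (ZMod.stdAddChar m) =
      (∏ w ∈ (nthRootsFinset n (1 : ℂ)).erase 1, f w) * ∏ w ∈ nthRootsFinset n (-1 : ℂ), f w := by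
  classical
  have hn : 0 < n := Nat.pos_of_ne_zero (NeZero.ne n)
  have h2n : 0 < 2 * n := by omega
  have himg : Finset.univ.image (fun m : ZMod (2 * n) => ZMod.stdAddChar m) =
      nthRootsFinset (2 * n) (1 : ℂ) := by
    refine Finset.eq_of_subset_of_card_le ?_ ?_
    · intro w hw
      obtain ⟨m, -, rfl⟩ := Finset.mem_image.1 hw
      rw [mem_nthRootsFinset h2n, ← AddChar.map_nsmul_eq_pow]
      simp
    · rw [card_nthRootsFinset_complex h2n one_ne_zero,
        Finset.card_image_of_injective _ ZMod.injective_stdAddChar]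
      simp
  have hdisj : Disjoint ((nthRootsFinset n (1 : ℂ)).erase 1) (nthRootsFinset n (-1 : ℂ)) := by
    rw [Finset.disjoint_left]
    intro w h1 h2
    rw [Finset.mem_erase, mem_nthRootsFinset hn] at h1
    rw [mem_nthRootsFinset hn, h1.2] at h2
    norm_num at h2
  have hunion : (Finset.univ.erase (0 : ZMod (2 * n))).image (fun m => ZMod.stdAddChar m) =
      (nthRootsFinset n (1 : ℂ)).erase 1 ∪ nthRootsFinset n (-1 : ℂ) := by
    rw [Finset.image_erase ZMod.injective_stdAddChar, himg, AddChar.map_zero_eq_one]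
    ext w
    simp only [Finset.mem_erase, Finset.mem_union, mem_nthRootsFinset hn, mem_nthRootsFinset h2n]
    have hsq : w ^ (2 * n) = 1 ↔ w ^ n = 1 ∨ w ^ n = -1 := by
      rw [← sq_eq_sq_iff_eq_or_eq_neg, one_pow, mul_comm, pow_mul]
    have hone : w ^ n = -1 → w ≠ 1 := by
      rintro h rfl
      norm_num at h
    tauto
  rw [← Finset.prod_union hdisj, ← hunion,
    Finset.prod_image fun _ _ _ _ h => ZMod.injective_stdAddChar h]

end RootsOfUnity

/-! ### Dickson polynomials and the form n·a(n) of the tree count -/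

section EvenExponential

open Polynomial

theorem monic_dickson_one_one {R : Type*} [CommRing R] [Nontrivial R] (n : ℕ) :
    (dickson 1 (1 : R) (n + 1)).Monic ∧ (dickson 1 (1 : R) (n + 1)).natDegree = n + 1 := by
  induction n using Nat.strong_induction_on with
  | _ n ih =>
    match n with
    | 0 => simp [dickson_one, monic_X]
    | 1 =>
      rw [dickson_two]
      have : (X ^ 2 - C (1 : R) * (3 - ((1 : ℕ) : R[X]))) = X ^ 2 - C (2 : R) := by
        rw [C_1, one_mul, C_ofNat]
        norm_num
      rw [this]
      exact ⟨monic_X_pow_sub_C _ two_ne_zero, natDegree_X_pow_sub_C⟩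
    | n + 2 =>
      obtain ⟨hm, hd⟩ := ih (n + 1) (by omega)
      obtain ⟨-, hd'⟩ := ih n (by omega)
      have hXm : (X * dickson 1 (1 : R) (n + 1 + 1)).Monic := monic_X.mul hm
      have hXd : (X * dickson 1 (1 : R) (n + 1 + 1)).natDegree = n + 3 := by
        rw [natDegree_X_mul hm.ne_zero, hd]
      have hrec : dickson 1 (1 : R) (n + 2 + 1) =
          X * dickson 1 (1 : R) (n + 1 + 1) - dickson 1 (1 : R) (n + 1) := by
        rw [dickson_add_two, C_1, one_mul]
      have hlt : (dickson 1 (1 : R) (n + 1)).natDegree <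
          (X * dickson 1 (1 : R) (n + 1 + 1)).natDegree := by omega
      rw [hrec]
      exact ⟨hXm.sub_of_left (degree_lt_degree hlt), by
        rw [natDegree_sub_eq_left_of_natDegree_lt hlt, hXd]⟩

theorem dickson_one_one_eval_two {R : Type*} [CommRing R] (n : ℕ) :
    (dickson 1 (1 : R) n).eval 2 = 2 := by
  have := dickson_one_one_eval_add_inv (1 : R) 1 (one_mul 1) n
  simpa [one_add_one_eq_two] using this

/-- Differentiating the recurrence at 2 gives 2 + 2(n + 1)² - n² = (n + 2)². It serves to show that
2 is a simple root of `stepPolynomial s`. -/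
theorem dickson_one_one_derivative_eval_two {R : Type*} [CommRing R] (n : ℕ) :
    (derivative (dickson 1 (1 : R) n)).eval 2 = (n : R) ^ 2 := by
  induction n using Nat.strong_induction_on with
  | _ n ih =>
    match n with
    | 0 =>
      have : dickson 1 (1 : R) 0 = C (2 : R) := by
        rw [dickson_zero, C_ofNat]
        norm_num
      simp [this]
    | 1 => simp [dickson_one]
    | n + 2 =>
      rw [dickson_add_two, C_1, one_mul]
      simp only [derivative_sub, derivative_mul, derivative_X, one_mul, eval_sub, eval_add,
        eval_mul, eval_X, ih n (by omega), ih (n + 1) (by omega), dickson_one_one_eval_two]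
      push_cast
      ring

/-- The polynomial whose value at `w + w⁻¹` is `∑ j, (2 - w ^ s j - w⁻¹ ^ s j)`. -/
noncomputable def stepPolynomial {k : ℕ} (s : Fin k → ℕ) : ℂ[X] :=
  ∑ j, (2 - dickson 1 (1 : ℂ) (s j))

theorem stepPolynomial_eval {k : ℕ} (s : Fin k → ℕ) {w : ℂ} (hw : w ≠ 0) :
    (stepPolynomial s).eval (w + w⁻¹) = ∑ j, (2 - w ^ s j - w⁻¹ ^ s j) := by
  simp [stepPolynomial, eval_finsetSum, dickson_one_one_eval_add_inv _ _ (mul_inv_cancel₀ hw),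
    sub_sub]

theorem stepPolynomial_eval_two {k : ℕ} (s : Fin k → ℕ) : (stepPolynomial s).eval 2 = 0 := by
  simp [stepPolynomial, eval_finsetSum, dickson_one_one_eval_two]

theorem stepPolynomial_derivative_eval_two {k : ℕ} (s : Fin k → ℕ) :
    (derivative (stepPolynomial s)).eval 2 = -∑ j, (s j : ℂ) ^ 2 := by
  simp [stepPolynomial, eval_finsetSum, dickson_one_one_derivative_eval_two]

/-- The largest step alone contributes in top degree, which is positive, so the constant does not
matter. Used with c = 0 and c = 2. -/
theorem leadingCoeff_stepPolynomial_add_C {k : ℕ} (hk : 1 ≤ k) {s : Fin k → ℕ}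
    (hs_pos : ∀ j, 1 ≤ s j) (hs : StrictMono s) (c : ℂ) :
    (stepPolynomial s + C c).leadingCoeff = -1 := by
  obtain ⟨k, rfl⟩ : ∃ l, k = l + 1 := ⟨k - 1, by omega⟩
  obtain ⟨d, hd⟩ : ∃ d, s (Fin.last k) = d + 1 := ⟨s (Fin.last k) - 1, by
    have := hs_pos (Fin.last k)
    omega⟩
  obtain ⟨hmonic, hdeg⟩ := monic_dickson_one_one (R := ℂ) d
  have hconst (a : ℂ) : C a ∈ degreeLT ℂ (d + 1) := by
    rw [mem_degreeLT]
    exact degree_C_le.trans_lt (by exact_mod_cast Nat.succ_pos d)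
  have hrest : ∑ j : Fin k, (2 - dickson 1 (1 : ℂ) (s j.castSucc)) + C (2 + c) ∈
      degreeLT ℂ (d + 1) := by
    refine add_mem (sum_mem fun j _ => sub_mem (by rw [← C_ofNat]; exact hconst 2) ?_) (hconst _)
    rw [mem_degreeLT]
    obtain ⟨e, he⟩ : ∃ e, s j.castSucc = e + 1 := ⟨s j.castSucc - 1, by
      have := hs_pos j.castSucc
      omega⟩
    have hlt : s j.castSucc < s (Fin.last k) := hs (Fin.castSucc_lt_last j)
    obtain ⟨hm, hdeg'⟩ := monic_dickson_one_one (R := ℂ) e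
    rw [he, degree_eq_natDegree hm.ne_zero, hdeg']
    exact_mod_cast (by omega : e + 1 < d + 1)
  have hsplit : stepPolynomial s + C c =
      (∑ j : Fin k, (2 - dickson 1 (1 : ℂ) (s j.castSucc)) + C (2 + c)) +
        -dickson 1 (1 : ℂ) (d + 1) := by
    rw [stepPolynomial, Fin.sum_univ_castSucc, hd, C_add, C_ofNat]
    ring
  rw [hsplit, leadingCoeff_add_of_degree_lt, leadingCoeff_neg, hmonic.leadingCoeff]
  rw [degree_neg, degree_eq_natDegree hmonic.ne_zero, hdeg]
  exact mem_degreeLT.1 hrest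

theorem exists_units_add_inv_eq (t : ℂ) : ∃ z : ℂˣ, (z : ℂ) + (z⁻¹ : ℂˣ) = t := by
  obtain ⟨z, hz⟩ := IsAlgClosed.exists_root (X ^ 2 - C t * X + 1 : ℂ[X]) (by
    have : (X ^ 2 - C t * X + 1 : ℂ[X]).degree = 2 := by compute_degree!
    rw [this]
    norm_num)
  simp only [IsRoot, eval_add, eval_sub, eval_pow, eval_X, eval_mul, eval_C, eval_one] at hz
  have hz0 : z ≠ 0 := by
    rintro rfl
    norm_num at hz
  refine ⟨Units.mk0 z hz0, ?_⟩
  rw [Units.val_inv_eq_inv_val, Units.val_mk0]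
  field_simp
  linear_combination hz

theorem prod_eval_multiset {ι : Type*} (S : Finset ι) (g : ι → ℂ) (c : ℂ) (M : Multiset ℂ) :
    ∏ w ∈ S, (C c * (M.map fun t => X - C t).prod).eval (g w) =
      c ^ S.card * (M.map fun t => ∏ w ∈ S, (g w - t)).prod := by
  simp only [eval_mul, eval_C, eval_multiset_prod, Multiset.map_map, Function.comp_def, eval_sub,
    eval_X]
  rw [Finset.prod_mul_distrib, Finset.prod_const]
  congr 1
  induction M using Multiset.induction with
  | empty => simp
  | cons t M ih => simp only [Multiset.map_cons, Multiset.prod_cons, Finset.prod_mul_distrib, ih]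

/-- The space of sequences spanned by the sequences `u ^ n + u⁻¹ ^ n`. -/
def evenExponentials : Submodule ℂ (ℕ → ℂ) :=
  Submodule.span ℂ (Set.range fun (u : ℂˣ) (n : ℕ) => (u : ℂ) ^ n + ((u⁻¹ : ℂˣ) : ℂ) ^ n)

theorem pow_add_inv_pow_mem (u : ℂˣ) :
    (fun n : ℕ => (u : ℂ) ^ n + ((u⁻¹ : ℂˣ) : ℂ) ^ n) ∈ evenExponentials :=
  Submodule.subset_span ⟨u, rfl⟩

theorem const_mem_evenExponentials (c : ℂ) : (fun _ : ℕ => c) ∈ evenExponentials := by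
  convert evenExponentials.smul_mem (c / 2) (pow_add_inv_pow_mem 1) using 1
  ext n
  simp
  ring

theorem neg_one_pow_mem_evenExponentials : (fun n : ℕ => (-1 : ℂ) ^ n) ∈ evenExponentials := by
  convert evenExponentials.smul_mem (1 / 2) (pow_add_inv_pow_mem (-1)) using 1
  ext n
  simp
  ring

/-- The product of the generators for u and v is the sum of those for uv and uv⁻¹. -/
theorem mul_mem_evenExponentials {f g : ℕ → ℂ} (hf : f ∈ evenExponentials)
    (hg : g ∈ evenExponentials) : f * g ∈ evenExponentials := by
  have h : evenExponentials * evenExponentials ≤ evenExponentials := by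
    conv_lhs => rw [evenExponentials, Submodule.span_mul_span]
    rw [Submodule.span_le]
    rintro _ ⟨_, ⟨u, rfl⟩, _, ⟨v, rfl⟩, rfl⟩
    rw [SetLike.mem_coe]
    convert evenExponentials.add_mem (pow_add_inv_pow_mem (u * v)) (pow_add_inv_pow_mem (u * v⁻¹))
      using 1
    ext n
    simp only [Pi.mul_apply, Pi.add_apply, Units.val_mul, mul_inv, inv_inv, mul_pow]
    ring
  exact h (Submodule.mul_mem_mul hf hg)

theorem multiset_prod_mem_evenExponentials {ι : Type*} (M : Multiset ι) (F : ι → ℕ → ℂ)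
    (h : ∀ t ∈ M, F t ∈ evenExponentials) :
    (fun n => (M.map fun t => F t n).prod) ∈ evenExponentials := by
  induction M using Multiset.induction with
  | empty => simpa using const_mem_evenExponentials 1
  | cons t M ih =>
    simp only [Multiset.map_cons, Multiset.prod_cons]
    exact mul_mem_evenExponentials (h t (Multiset.mem_cons_self _ _))
      (ih fun t' ht' => h t' (Multiset.mem_cons_of_mem ht'))

theorem exists_numSpanningTrees_eq_mul {k : ℕ} (hk : 1 ≤ k) {s : Fin k → ℕ}
    (hs_pos : ∀ j, 1 ≤ s j) (hs : StrictMono s) :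
    ∃ a ∈ evenExponentials, ∀ n : ℕ, 0 < n →
      ((oddCirculant n s).numSpanningTrees : ℂ) = n * a n := by
  obtain ⟨M₀, hM₀⟩ : ∃ M₀ : Multiset ℂ,
      stepPolynomial s = C (-1) * ((2 ::ₘ M₀).map fun t => X - C t).prod := by
    have hlead := leadingCoeff_stepPolynomial_add_C hk hs_pos hs 0
    rw [C_0, add_zero] at hlead
    have hne : stepPolynomial s ≠ 0 := by
      rintro h
      simp [h] at hlead
    obtain ⟨M, hM⟩ := Multiset.exists_cons_of_mem
      ((mem_roots hne).2 (stepPolynomial_eval_two s))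
    refine ⟨M, ?_⟩
    rw [← hM, ← hlead]
    exact (IsAlgClosed.splits _).eq_prod_roots
  obtain ⟨M₁, hM₁⟩ : ∃ M₁ : Multiset ℂ,
      stepPolynomial s + C 2 = C (-1) * (M₁.map fun t => X - C t).prod := by
    refine ⟨(stepPolynomial s + C 2).roots, ?_⟩
    rw [← leadingCoeff_stepPolynomial_add_C hk hs_pos hs 2]
    exact (IsAlgClosed.splits _).eq_prod_roots
  -- A second root at 2 would make the derivative there, -∑ s_j², vanish. Simplicity lets `F₀`
  -- divide by 2 - t.
  have hM₀two : (2 : ℂ) ∉ M₀ := by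
    intro hmem
    have h1 := stepPolynomial_derivative_eval_two s
    obtain ⟨M, rfl⟩ := Multiset.exists_cons_of_mem hmem
    rw [hM₀] at h1
    simp only [Multiset.map_cons, Multiset.prod_cons, derivative_mul, derivative_C, derivative_sub,
      derivative_X, eval_add, eval_mul, eval_sub, eval_X, eval_C, sub_self, zero_mul, mul_zero,
      add_zero, eval_zero] at h1
    have h2 : (0 : ℝ) < ∑ j, (s j : ℝ) ^ 2 :=
      Finset.sum_pos (fun j _ => by have := hs_pos j; positivity) ⟨⟨0, hk⟩, Finset.mem_univ _⟩
    refine h2.ne' ?_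
    have h3 : ((∑ j, (s j : ℝ) ^ 2 : ℝ) : ℂ) = 0 := by
      push_cast
      linear_combination h1
    exact_mod_cast h3
  choose z hz using exists_units_add_inv_eq
  let F₀ : ℂ → ℕ → ℂ := fun t n =>
    (2 - t)⁻¹ * ((-1) ^ n * ((z t : ℂ) ^ n + (((z t)⁻¹ : ℂˣ) : ℂ) ^ n - 2))
  let F₁ : ℂ → ℕ → ℂ := fun t n =>
    (-1) ^ n * ((z t : ℂ) ^ n + (((z t)⁻¹ : ℂˣ) : ℂ) ^ n - 2 * (-1))
  have hF₀ (t : ℂ) : F₀ t ∈ evenExponentials :=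
    evenExponentials.smul_mem _ (mul_mem_evenExponentials neg_one_pow_mem_evenExponentials
      (sub_mem (pow_add_inv_pow_mem (z t)) (const_mem_evenExponentials 2)))
  have hF₁ (t : ℂ) : F₁ t ∈ evenExponentials :=
    mul_mem_evenExponentials neg_one_pow_mem_evenExponentials
      (sub_mem (pow_add_inv_pow_mem (z t)) (const_mem_evenExponentials _))
  -- The product of eigenvalues is 2n·τ(n), and n² comes from the root 2, leaving n/2. The extra
  -- (-1)ⁿ is the leading coefficient -1 of P + 2 taken over n roots; for P the sign cancels against
  -- that of the root 2.
  refine ⟨(1 / 2 : ℂ) • ((fun n => (M₀.map fun t => F₀ t n).prod) *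
    ((fun n => (-1) ^ n) * fun n => (M₁.map fun t => F₁ t n).prod)),
    evenExponentials.smul_mem _ (mul_mem_evenExponentials
      (multiset_prod_mem_evenExponentials _ _ fun t _ => hF₀ t)
      (mul_mem_evenExponentials neg_one_pow_mem_evenExponentials
        (multiset_prod_mem_evenExponentials _ _ fun t _ => hF₁ t))), fun n hn => ?_⟩
  have : NeZero n := ⟨hn.ne'⟩
  have hroot {a : ℂ} (ha : a ≠ 0) {w : ℂ} (hw : w ∈ nthRootsFinset n a) : w ≠ 0 := by
    rintro rfl
    rw [mem_nthRootsFinset hn, zero_pow hn.ne'] at hw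
    exact ha hw.symm
  have hprod := mul_numSpanningTrees_oddCirculant n s
  have hev (m : ZMod (2 * n)) : circulantEigenvalue n s m =
      (fun w : ℂ => ∑ j, (2 - w ^ s j - w⁻¹ ^ s j) + (1 - w ^ n)) (ZMod.stdAddChar m) := by
    simp only [circulantEigenvalue, ← nsmul_eq_mul, AddChar.map_nsmul_eq_pow,
      AddChar.map_neg_eq_inv, inv_pow]
  have heven : ∏ w ∈ (nthRootsFinset n (1 : ℂ)).erase 1,
      (∑ j, (2 - w ^ s j - w⁻¹ ^ s j) + (1 - w ^ n)) =
      (n : ℂ) ^ 2 * (M₀.map fun t => F₀ t n).prod := by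
    have h1 : ∀ w ∈ (nthRootsFinset n (1 : ℂ)).erase 1,
        (∑ j, (2 - w ^ s j - w⁻¹ ^ s j) + (1 - w ^ n)) =
        (C (-1) * ((2 ::ₘ M₀).map fun t => X - C t).prod).eval (w + w⁻¹) := by
      intro w hw
      have hw := (Finset.mem_erase.1 hw).2
      rw [← hM₀, stepPolynomial_eval s (hroot one_ne_zero hw), (mem_nthRootsFinset hn 1).1 hw,
        sub_self, add_zero]
    rw [Finset.prod_congr rfl h1, prod_eval_multiset,
      Finset.card_erase_of_mem (one_mem_nthRootsFinset_one hn),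
      card_nthRootsFinset_complex hn one_ne_zero, Multiset.map_cons, Multiset.prod_cons,
      prod_nthRootsFinset_erase_one_add_inv_sub_two hn, ← mul_assoc, ← mul_assoc, ← mul_pow,
      neg_one_mul, neg_neg, one_pow, one_mul]
    congr 2
    refine Multiset.map_congr rfl fun t ht => ?_
    have h2 := prod_nthRootsFinset_erase_one_add_inv_sub hn (z t) (by
      rw [hz]
      rintro rfl
      exact hM₀two ht)
    rwa [hz] at h2
  have hodd : ∏ w ∈ nthRootsFinset n (-1 : ℂ),
      (∑ j, (2 - w ^ s j - w⁻¹ ^ s j) + (1 - w ^ n)) =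
      (-1) ^ n * (M₁.map fun t => F₁ t n).prod := by
    have h1 : ∀ w ∈ nthRootsFinset n (-1 : ℂ),
        (∑ j, (2 - w ^ s j - w⁻¹ ^ s j) + (1 - w ^ n)) =
        (C (-1) * (M₁.map fun t => X - C t).prod).eval (w + w⁻¹) := by
      intro w hw
      rw [← hM₁, eval_add, eval_C, stepPolynomial_eval s (hroot (by norm_num) hw),
        (mem_nthRootsFinset hn (-1)).1 hw]
      norm_num
    rw [Finset.prod_congr rfl h1, prod_eval_multiset,
      card_nthRootsFinset_complex hn (by norm_num)]
    congr 2
    refine Multiset.map_congr rfl fun t _ => ?_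
    have h2 := prod_nthRootsFinset_add_inv_sub hn (a := -1) (by norm_num) (z t)
    rwa [hz] at h2
  rw [Finset.prod_congr rfl fun m _ => hev m, prod_stdAddChar_erase_zero n
    (fun w : ℂ => ∑ j, (2 - w ^ s j - w⁻¹ ^ s j) + (1 - w ^ n)), heven, hodd] at hprod
  have hn0 : (n : ℂ) ≠ 0 := Nat.cast_ne_zero.2 hn.ne'
  refine mul_left_cancel₀ (mul_ne_zero two_ne_zero hn0) ?_
  simp only [Pi.smul_apply, Pi.mul_apply, smul_eq_mul]
  push_cast at hprod
  rw [hprod]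
  ring

end EvenExponential

/-! ### Palindromic rational series and the symmetry under x ↦ 1/x -/

section Palindromic

open Polynomial

/-- A power series is palindromic rational if it is the quotient of two polynomials that are both
palindromic with respect to the same degree. -/
def PowerSeries.IsPalindromicRational {K : Type*} [Field K] (f : K⟦X⟧) : Prop :=
  ∃ (N : ℕ) (P Q : K[X]), Q ≠ 0 ∧ P.natDegree ≤ N ∧ Q.natDegree ≤ N ∧
    P.reflect N = P ∧ Q.reflect N = Q ∧ (Q : K⟦X⟧) * f = P

namespace PowerSeries.IsPalindromicRational

variable {K : Type*} [Field K] {f g : K⟦X⟧}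

theorem zero : (0 : K⟦X⟧).IsPalindromicRational :=
  ⟨0, 0, 1, one_ne_zero, by simp, by simp, by simp, by simp, by simp⟩

theorem add (hf : f.IsPalindromicRational) (hg : g.IsPalindromicRational) :
    (f + g).IsPalindromicRational := by
  obtain ⟨N, P, Q, hQ, hPN, hQN, hPr, hQr, h⟩ := hf
  obtain ⟨M, R, S, hS, hRM, hSM, hRr, hSr, h'⟩ := hg
  refine ⟨N + M, P * S + Q * R, Q * S, mul_ne_zero hQ hS, ?_, ?_, ?_, ?_, ?_⟩
  · exact natDegree_add_le_of_degree_le (natDegree_mul_le_of_le hPN hSM)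
      (natDegree_mul_le_of_le hQN hRM)
  · exact natDegree_mul_le_of_le hQN hSM
  · rw [reflect_add, reflect_mul _ _ hPN hSM, reflect_mul _ _ hQN hRM, hPr, hSr, hQr, hRr]
  · rw [reflect_mul _ _ hQN hSM, hQr, hSr]
  · push_cast
    linear_combination (S : K⟦X⟧) * h + (Q : K⟦X⟧) * h'

theorem smul (c : K) (hf : f.IsPalindromicRational) : (c • f).IsPalindromicRational := by
  obtain ⟨N, P, Q, hQ, hPN, hQN, hPr, hQr, h⟩ := hf
  refine ⟨N, Polynomial.C c * P, Q, hQ, (natDegree_C_mul_le _ _).trans hPN, hQN, ?_, hQr, ?_⟩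
  · rw [reflect_C_mul, hPr]
  · rw [Polynomial.coe_mul, Polynomial.coe_C, PowerSeries.smul_eq_C_mul]
    linear_combination PowerSeries.C c * h

theorem one_sub_sq_mul_mk_mul_pow (u : K) :
    (1 - PowerSeries.C u * PowerSeries.X) ^ 2 * PowerSeries.mk (fun n => (n : K) * u ^ n) =
      PowerSeries.C u * PowerSeries.X := by
  have h1 : (1 - PowerSeries.C u * PowerSeries.X) * PowerSeries.mk (fun n => u ^ n) = 1 := by
    ext n
    rw [sub_mul, one_mul, mul_assoc, map_sub, PowerSeries.coeff_C_mul]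
    cases n with
    | zero => simp
    | succ n =>
      rw [PowerSeries.coeff_succ_X_mul]
      simp [PowerSeries.coeff_one, pow_succ']
  have h2 : (1 - PowerSeries.C u * PowerSeries.X) * PowerSeries.mk (fun n => (n : K) * u ^ n) =
      PowerSeries.C u * PowerSeries.X * PowerSeries.mk (fun n => u ^ n) := by
    ext n
    rw [sub_mul, one_mul, mul_assoc, mul_assoc, map_sub, PowerSeries.coeff_C_mul,
      PowerSeries.coeff_C_mul]
    cases n with
    | zero => simp
    | succ n =>
      rw [PowerSeries.coeff_succ_X_mul, PowerSeries.coeff_succ_X_mul]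
      simp only [PowerSeries.coeff_mk]
      push_cast
      ring
  rw [sq, mul_assoc, h2]
  linear_combination PowerSeries.C u * PowerSeries.X * h1

theorem mk_mul_pow_add_pow {u v : K} (huv : u * v = 1) :
    (PowerSeries.mk fun n => (n : K) * (u ^ n + v ^ n)).IsPalindromicRational := by
  set t := u + v with ht
  have hD : (1 - Polynomial.C t * Polynomial.X + Polynomial.X ^ 2 : K[X]).natDegree ≤ 2 := by
    compute_degree
  have hDr : (1 - Polynomial.C t * Polynomial.X + Polynomial.X ^ 2 : K[X]).reflect 2 =
      1 - Polynomial.C t * Polynomial.X + Polynomial.X ^ 2 := by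
    have h1 := reflect_C_mul_X_pow 2 1 (c := t)
    have h2 := reflect_monomial (R := K) 2 2
    rw [pow_one] at h1
    rw [reflect_add, reflect_sub, reflect_one, h1, h2, revAt_le one_le_two, revAt_le le_rfl]
    simp
    ring
  -- With uv = 1, (1 - ux)(1 - vx) = 1 - tx + x², and the numerator is ux(1 - vx)² + vx(1 - ux)² =
  -- tx - 4x² + tx³.
  refine ⟨4, Polynomial.C t * Polynomial.X + Polynomial.C (-4) * Polynomial.X ^ 2 +
    Polynomial.C t * Polynomial.X ^ 3, (1 - Polynomial.C t * Polynomial.X + Polynomial.X ^ 2) *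
      (1 - Polynomial.C t * Polynomial.X + Polynomial.X ^ 2), ?_, by compute_degree!,
      natDegree_mul_le_of_le hD hD, ?_, ?_, ?_⟩
  · intro h
    have := congrArg (Polynomial.eval 0) h
    simp at this
  · have h1 := reflect_C_mul_X_pow 4 1 (c := t)
    rw [pow_one] at h1
    rw [reflect_add, reflect_add, h1, reflect_C_mul_X_pow, reflect_C_mul_X_pow,
      revAt_le (by norm_num), revAt_le (by norm_num), revAt_le (by norm_num)]
    norm_num
    ring
  · rw [reflect_mul (F := 2) (G := 2) _ _ hD hD, hDr]
  · have hsplit : (PowerSeries.mk fun n => (n : K) * (u ^ n + v ^ n)) =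
        PowerSeries.mk (fun n => (n : K) * u ^ n) + PowerSeries.mk (fun n => (n : K) * v ^ n) := by
      ext n
      simp [mul_add]
    have hC : (PowerSeries.C u : K⟦X⟧) * PowerSeries.C v = 1 := by
      rw [← map_mul, huv, map_one]
    have hu := one_sub_sq_mul_mk_mul_pow u
    have hv := one_sub_sq_mul_mk_mul_pow v
    have hfac : (1 - PowerSeries.C u * PowerSeries.X) * (1 - PowerSeries.C v * PowerSeries.X) =
        (1 - (PowerSeries.C u + PowerSeries.C v) * PowerSeries.X + PowerSeries.X ^ 2 : K⟦X⟧) := by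
      linear_combination (PowerSeries.X : K⟦X⟧) ^ 2 * hC
    rw [hsplit, ht]
    push_cast
    simp only [map_add, map_neg]
    rw [← hfac]
    have h4 : (PowerSeries.C 4 : K⟦X⟧) = 4 := map_ofNat _ 4
    rw [h4]
    linear_combination (1 - PowerSeries.C v * PowerSeries.X) ^ 2 * hu +
      (1 - PowerSeries.C u * PowerSeries.X) ^ 2 * hv +
      (PowerSeries.X ^ 3 * (PowerSeries.C u + PowerSeries.C v) - 4 * PowerSeries.X ^ 2) * hC

/-- Palindromic rationality descends to a subfield. -/
theorem of_map {L : Type*} [Field L] [Algebra K L] {f : K⟦X⟧}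
    (hf : (f.map (algebraMap K L)).IsPalindromicRational) : f.IsPalindromicRational := by
  obtain ⟨N, P, Q, hQ, hPN, hQN, hPr, hQr, h⟩ := hf
  obtain ⟨i, hi⟩ : ∃ i, Q.coeff i ≠ 0 := by
    by_contra! hall
    exact hQ (Polynomial.ext hall)
  -- As f has coefficients in K, the relation Qf = P is K-linear in the coefficients of P and Q.
  -- Applying φ to them keeps the relation and the palindromes, and this choice of φ keeps Q
  -- nonzero.
  obtain ⟨φ, hφ⟩ : ∃ φ : L →ₗ[K] K, φ (Q.coeff i) ≠ 0 := by
    by_contra! hall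
    exact hi ((Module.forall_dual_apply_eq_zero_iff K _).1 hall)
  let A : L[X] → K[X] := fun R => ∑ j ∈ Finset.range (N + 1), Polynomial.monomial j (φ (R.coeff j))
  have hA {R : L[X]} (hR : R.natDegree ≤ N) (j : ℕ) : (A R).coeff j = φ (R.coeff j) := by
    simp only [A, finsetSum_coeff, Polynomial.coeff_monomial, Finset.sum_ite_eq',
      Finset.mem_range]
    split_ifs with hj
    · rfl
    · rw [Polynomial.coeff_eq_zero_of_natDegree_lt (by omega), map_zero]
  have hdeg (R : L[X]) : (A R).natDegree ≤ N :=
    natDegree_sum_le_of_forall_le _ _ fun j hj =>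
      (natDegree_monomial_le _).trans (Nat.lt_succ_iff.1 (Finset.mem_range.1 hj))
  have hrefl {R : L[X]} (hR : R.natDegree ≤ N) (hr : R.reflect N = R) :
      (A R).reflect N = A R := by
    ext j
    rw [coeff_reflect, hA hR, hA hR, ← coeff_reflect, hr]
  refine ⟨N, A P, A Q, fun h0 => hφ ?_, hdeg P, hdeg Q, hrefl hPN hPr, hrefl hQN hQr, ?_⟩
  · rw [← hA hQN, h0, Polynomial.coeff_zero]
  · ext n
    have hn := congrArg (fun g => φ (PowerSeries.coeff n g)) h
    simp only [PowerSeries.coeff_mul, Polynomial.coeff_coe, PowerSeries.coeff_map, map_sum] at hn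
    rw [Polynomial.coeff_coe, hA hPN, ← hn, PowerSeries.coeff_mul]
    refine Finset.sum_congr rfl fun p _ => ?_
    rw [Polynomial.coeff_coe, hA hQN, mul_comm (Q.coeff _), ← Algebra.smul_def, map_smul,
      smul_eq_mul, mul_comm]

end PowerSeries.IsPalindromicRational

theorem isPalindromicRational_of_mem_evenExponentials {a : ℕ → ℂ} (ha : a ∈ evenExponentials) :
    (PowerSeries.mk fun n => (n : ℂ) * a n).IsPalindromicRational := by
  induction ha using Submodule.span_induction with
  | mem f hf =>
    obtain ⟨u, rfl⟩ := hf
    exact .mk_mul_pow_add_pow (Units.mul_inv u)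
  | zero =>
    convert PowerSeries.IsPalindromicRational.zero (K := ℂ) using 1
    ext n
    simp
  | add f g _ _ hf hg =>
    convert hf.add hg using 1
    ext n
    simp [mul_add]
  | smul c f _ hf =>
    convert hf.smul c using 1
    ext n
    simp
    ring

theorem RatFunc.coe_div_eq_powerSeries {K : Type*} [Field K] {P Q : K[X]} (hQ : Q ≠ 0) {f : K⟦X⟧}
    (h : (Q : K⟦X⟧) * f = P) :
    ((algebraMap K[X] (RatFunc K) P / algebraMap K[X] (RatFunc K) Q : RatFunc K) : K⸨X⸩) =
      (f : K⸨X⸩) := by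
  have hlaurent := congrArg (fun g : K⟦X⟧ => (g : K⸨X⸩)) h
  simp only [PowerSeries.coe_mul, RatFunc.coe_coe] at hlaurent
  have hQl : ((algebraMap K[X] (RatFunc K) Q : RatFunc K) : K⸨X⸩) ≠ 0 :=
    (map_ne_zero_iff _ (algebraMap (RatFunc K) K⸨X⸩).injective).2 (RatFunc.algebraMap_ne_zero hQ)
  rw [map_div₀, div_eq_iff hQl, mul_comm]
  exact hlaurent.symm

/-- Palindromicity says x^N P(1/x) = P(x), and likewise for Q with the same N, so the powers cancel
in the quotient. -/
theorem RatFunc.eval_inv_X_div_eq_self {K : Type*} [Field K] {N : ℕ} {P Q : K[X]} (hQ : Q ≠ 0)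
    (hPN : P.natDegree ≤ N) (hQN : Q.natDegree ≤ N) (hPr : P.reflect N = P)
    (hQr : Q.reflect N = Q) :
    (algebraMap K[X] (RatFunc K) P / algebraMap K[X] (RatFunc K) Q).eval
      (algebraMap K (RatFunc K)) (RatFunc.X)⁻¹ =
      algebraMap K[X] (RatFunc K) P / algebraMap K[X] (RatFunc K) Q := by
  have hinv : Invertible (RatFunc.X : RatFunc K) := invertibleOfNonzero RatFunc.X_ne_zero
  have heval (R : K[X]) : R.eval₂ (algebraMap K (RatFunc K)) RatFunc.X = algebraMap _ _ R :=
    RatFunc.aeval_X_left_eq_algebraMap R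
  have hne {R : K[X]} (hR : R ≠ 0) :
      R.eval₂ (algebraMap K (RatFunc K)) (RatFunc.X)⁻¹ ≠ 0 := by
    intro h0
    have h1 := eval₂_reflect_mul_pow (algebraMap K (RatFunc K)) RatFunc.X R.natDegree
      (R.reflect R.natDegree) (natDegree_reflect_le.trans (max_self _).le)
    rw [reflect_reflect, invOf_eq_inv, h0, zero_mul, heval] at h1
    exact hR (reflect_eq_zero_iff.1 ((map_eq_zero_iff _ (RatFunc.algebraMap_injective K)).1 h1.symm))
  have hPe := eval₂_reflect_mul_pow (algebraMap K (RatFunc K)) RatFunc.X N P hPN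
  have hQe := eval₂_reflect_mul_pow (algebraMap K (RatFunc K)) RatFunc.X N Q hQN
  rw [hPr, invOf_eq_inv, heval] at hPe
  rw [hQr, invOf_eq_inv, heval] at hQe
  set F := algebraMap K[X] (RatFunc K) P / algebraMap K[X] (RatFunc K) Q with hF
  -- `RatFunc.eval` uses the reduced fraction, so it is compared with P/Q by cross-multiplication.
  have hnum : F.num * Q = P * F.denom := (RatFunc.num_mul_eq_mul_denom_iff hQ).2 hF
  have hnum' := congrArg (Polynomial.eval₂ (algebraMap K (RatFunc K)) (RatFunc.X)⁻¹) hnum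
  rw [eval₂_mul, eval₂_mul] at hnum'
  rw [RatFunc.eval, (div_eq_div_iff (hne F.denom_ne_zero) (hne hQ)).2 hnum', hF, ← hPe, ← hQe,
    mul_div_mul_right _ _ (pow_ne_zero N RatFunc.X_ne_zero)]

theorem RatFunc.aeval_X_int_eq_algebraMap_map (S : ℤ[X]) :
    Polynomial.aeval (RatFunc.X : RatFunc ℚ) S =
      algebraMap ℚ[X] (RatFunc ℚ) (S.map (algebraMap ℤ ℚ)) := by
  have h : (Polynomial.aeval (RatFunc.X : RatFunc ℚ)).toRingHom =
      (algebraMap ℚ[X] (RatFunc ℚ)).comp (Polynomial.mapRingHom (algebraMap ℤ ℚ)) := by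
    refine Polynomial.ringHom_ext' (RingHom.ext_int _ _) ?_
    simp
  exact congrArg (fun φ : ℤ[X] →+* RatFunc ℚ => φ S) h

theorem exists_int_polynomials_of_div {P Q : ℚ[X]} (hQ : Q ≠ 0) :
    ∃ S T : ℤ[X], T ≠ 0 ∧ algebraMap ℚ[X] (RatFunc ℚ) P / algebraMap ℚ[X] (RatFunc ℚ) Q =
      Polynomial.aeval (RatFunc.X : RatFunc ℚ) S / Polynomial.aeval RatFunc.X T := by
  have hnorm (R : ℚ[X]) : ∃ (b : ℤ) (S : ℤ[X]), b ≠ 0 ∧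
      Polynomial.aeval (RatFunc.X : RatFunc ℚ) S = (b : RatFunc ℚ) * algebraMap _ _ R := by
    obtain ⟨b, hb, hS⟩ := IsLocalization.integerNormalization_spec (nonZeroDivisors ℤ) R
    refine ⟨b, IsLocalization.integerNormalization (nonZeroDivisors ℤ) R,
      nonZeroDivisors.ne_zero hb, ?_⟩
    rw [RatFunc.aeval_X_int_eq_algebraMap_map, hS, zsmul_eq_mul, map_mul, map_intCast]
  obtain ⟨b, S, hb, hS⟩ := hnorm P
  obtain ⟨c, T, hc, hT⟩ := hnorm Q
  have hb' : (b : RatFunc ℚ) ≠ 0 := Int.cast_ne_zero.2 hb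
  have hc' : (c : RatFunc ℚ) ≠ 0 := Int.cast_ne_zero.2 hc
  have hQ' : algebraMap ℚ[X] (RatFunc ℚ) Q ≠ 0 := RatFunc.algebraMap_ne_zero hQ
  refine ⟨Polynomial.C c * S, Polynomial.C b * T, ?_, ?_⟩
  · refine mul_ne_zero (Polynomial.C_ne_zero.2 hb) ?_
    rintro rfl
    rw [map_zero] at hT
    exact mul_ne_zero hc' hQ' hT.symm
  · rw [map_mul, map_mul, Polynomial.aeval_C, Polynomial.aeval_C, hS, hT, eq_intCast, eq_intCast]
    field_simp

theorem exists_ratFunc_of_isPalindromicRational {f : ℚ⟦X⟧} (hf : f.IsPalindromicRational) :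
    ∃ F : RatFunc ℚ,
      (∃ P Q : ℤ[X], Q ≠ 0 ∧
        F = Polynomial.aeval (RatFunc.X : RatFunc ℚ) P / Polynomial.aeval RatFunc.X Q) ∧
      (F : ℚ⸨X⸩) = (f : ℚ⸨X⸩) ∧
      F.eval (algebraMap ℚ (RatFunc ℚ)) (RatFunc.X)⁻¹ = F := by
  obtain ⟨N, P, Q, hQ, hPN, hQN, hPr, hQr, h⟩ := hf
  refine ⟨algebraMap _ _ P / algebraMap _ _ Q, exists_int_polynomials_of_div hQ,
    RatFunc.coe_div_eq_powerSeries hQ h, ?_⟩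
  convert RatFunc.eval_inv_X_div_eq_self hQ hPN hQN hPr hQr using 2
  exact Subsingleton.elim _ _

end Palindromic

theorem theorem5p3 {k : ℕ} (hk : 1 ≤ k) (s : Fin k → ℕ) (hs_pos : ∀ j, 1 ≤ s j)
    (hs : StrictMono s) :
    ∃ F : RatFunc ℚ,
      -- `F` is a quotient of two polynomials with integer coefficients
      (∃ P Q : ℤ[X], Q ≠ 0 ∧
        F = Polynomial.aeval (RatFunc.X : RatFunc ℚ) P / Polynomial.aeval RatFunc.X Q) ∧
      -- the expansion of `F` at `0` is the generating function
      (F : ℚ⸨X⸩) = (spanningTreeSeries s : ℚ⸨X⸩) ∧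
      -- substituting `1 / x` for `x` in `F` gives `F`
      F.eval (algebraMap ℚ (RatFunc ℚ)) (RatFunc.X)⁻¹ = F := by
  obtain ⟨a, ha, htree⟩ := exists_numSpanningTrees_eq_mul hk hs_pos hs
  refine exists_ratFunc_of_isPalindromicRational (.of_map (L := ℂ) ?_)
  convert isPalindromicRational_of_mem_evenExponentials ha using 1
  ext n
  -- The value a(0) is irrelevant: the factor n kills it, matching the zero constant term of the
  -- series.
  rcases Nat.eq_zero_or_pos n with rfl | hn
  · simp [spanningTreeSeries]
  · simp [spanningTreeSeries, hn.ne', htree n hn]
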